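/- Let $\mathcal H$ be a complex Hilbert space, $\mathcal B(\mathcal H)$ the algebra of bounded operators on $\mathcal H$, and let $T:\mathbb Z_3\to\mathcal B(\mathcal H)$ be any map. Call $T$ positive definite if $T(-s)=T(s)^*$ for every $s\in\mathbb Z_3$ and $\sum_{s,t\in\mathbb Z_3}\langle T(-t+s)h(s),h(t)\rangle\ge 0$ for every $h:\mathbb Z_3\to\mathcal H$. For a contraction $\Gamma:\mathcal E\to\mathcal E$ on a Hilbert space $\mathcal E$ let $D_\Gamma=(I-\Gamma^*\Gamma)^{1/2}$ and $\mathfrak D_\Gamma=\overline{D_\Gamma\mathcal E}$. Then the following are equivalent. (1) $T$ is a positive definite function. (2) $T(2)=T(1)^*$, and the block matrix $$\Delta_T=\begin{bmatrix} T(0) & T(1) & T(1)^*\\ T(1)^* & T(0) & T(1)\\ T(1) & T(1)^* & T(0)\end{bmatrix}$$ is a bounded positive operator on $\mathcal H^3$. (3) $T(2)=T(1)^*$, the operator $T(0)$ is positive, and there are contractions $\Gamma_0:\overline{T(0)\mathcal H}\to\overline{T(0)\mathcal H}$ and $\Gamma_1:\mathfrak D_{\Gamma_0}\to\mathfrak D_{\Gamma_0^*}$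 such that $$T(1)=T(0)^{1/2}\,\Gamma_0\,T(0)^{1/2}$$ and $$T(1)^*=T(0)^{1/2}D_{\Gamma_0^*}\Gamma_1D_{\Gamma_0}T(0)^{1/2}+T(0)^{1/2}\Gamma_0^2\,T(0)^{1/2}.$$ -/

import Mathlib

open scoped ComplexOrder InnerProduct

noncomputable section

namespace PosDefZ3

variable {H : Type*} [NormedAddCommGroup H] [InnerProductSpace ℂ H]

/-- Operator-valued positive definite functions on a group written additively, so that
`t⁻¹ s` reads `-t + s`. The finitely supported functions `G →₀ H` are the space `c₀₀(G, H)`, and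
`inner ℂ y x` is linear in `x`, so that it is the pairing `⟨x, y⟩` linear in the first slot.
`0 ≤ z` for a complex number means that `z` is real and nonnegative. -/
def IsPositiveDefinite [CompleteSpace H] {G : Type*} [AddGroup G] (T : G → H →L[ℂ] H) : Prop :=
  (∀ s : G, T (-s) = ContinuousLinearMap.adjoint (T s)) ∧
    ∀ h : G →₀ H,
      0 ≤ ∑ s ∈ h.support, ∑ t ∈ h.support, inner ℂ (h t) (T (-t + s) (h s))

/-- The bounded operator on the Hilbert space direct sum `Hⁿ` given by a block matrix:
`(A x) i = ∑ j, A i j (x j)`. -/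
def blockOperator {n : ℕ} (A : Matrix (Fin n) (Fin n) (H →L[ℂ] H)) :
    PiLp 2 (fun _ : Fin n => H) →L[ℂ] PiLp 2 (fun _ : Fin n => H) :=
  ((PiLp.continuousLinearEquiv 2 ℂ (fun _ : Fin n => H)).symm :
      (Fin n → H) →L[ℂ] PiLp 2 (fun _ : Fin n => H)) ∘L
    ContinuousLinearMap.pi
      (fun i => ∑ j, A i j ∘L PiLp.proj (𝕜 := ℂ) 2 (fun _ : Fin n => H) j)

theorem blockOperator_apply {n : ℕ} (A : Matrix (Fin n) (Fin n) (H →L[ℂ] H))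
    (x : PiLp 2 (fun _ : Fin n => H)) (i : Fin n) :
    blockOperator A x i = ∑ j, A i j (x j) := by
  simp [blockOperator]

/-- The closure of the range of an operator, as a closed subspace of its codomain. -/
abbrev closedRange {E F : Type*} [NormedAddCommGroup E] [InnerProductSpace ℂ E]
    [NormedAddCommGroup F] [InnerProductSpace ℂ F] (A : E →L[ℂ] F) : Submodule ℂ F :=
  A.range.topologicalClosure

variable [CompleteSpace H]

theorem sqrt_mem_closedRange (A : H →L[ℂ] H) (x : H) : CFC.sqrt A x ∈ closedRange A := by
  by_cases hA : 0 ≤ A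
  · have hS : 0 ≤ CFC.sqrt A := CFC.sqrt_nonneg A
    have hsym : (CFC.sqrt A).IsSymmetric :=
      ((ContinuousLinearMap.nonneg_iff_isPositive _).1 hS).isSymmetric
    have hmul : ∀ v, CFC.sqrt A (CFC.sqrt A v) = A v := fun v => by
      rw [← mul_apply_eq_comp, CFC.sqrt_mul_sqrt_self A hA]
    rw [closedRange, ← Submodule.orthogonal_orthogonal_eq_closure, Submodule.mem_orthogonal]
    intro u hu
    have h0 : CFC.sqrt A u = 0 := by
      have h1 : inner ℂ (A u) u = 0 := (Submodule.mem_orthogonal _ _).1 hu _ ⟨u, rfl⟩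
      rw [← hmul u] at h1
      have h2 := hsym (CFC.sqrt A u) u
      simp only [ContinuousLinearMap.coe_coe] at h2
      rw [h2] at h1
      exact inner_self_eq_zero.1 h1
    have h3 := hsym u x
    simp only [ContinuousLinearMap.coe_coe] at h3
    rw [← h3, h0, inner_zero_left]
  · have : CFC.sqrt A = 0 := by
      rw [CFC.sqrt]
      exact cfcₙ_apply_of_not_predicate _ hA
    rw [this]
    exact Submodule.zero_mem _

/-- The positive square root `A^{1/2}`, regarded as an operator from `H` into the closure of the
range of `A`. -/
def sqrtToClosedRange (A : H →L[ℂ] H) : H →L[ℂ] closedRange A :=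
  (CFC.sqrt A).codRestrict (closedRange A) (sqrt_mem_closedRange A)

/-- The positive square root `A^{1/2}`, restricted to the closure of the range of `A`. -/
def sqrtOnClosedRange (A : H →L[ℂ] H) : closedRange A →L[ℂ] H :=
  CFC.sqrt A ∘L (closedRange A).subtypeL

/-- The defect operator `D_Γ = (I - Γ* Γ)^{1/2}` of a contraction `Γ`. -/
def defectOp (Γ : H →L[ℂ] H) : H →L[ℂ] H :=
  CFC.sqrt (1 - ContinuousLinearMap.adjoint Γ ∘L Γ)

/-- The defect space `𝔇_Γ`, the closure of the range of `D_Γ`. -/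
abbrev defectSpace (Γ : H →L[ℂ] H) : Submodule ℂ H :=
  closedRange (defectOp Γ)

/-- The defect operator `D_Γ`, regarded as an operator from `H` into `𝔇_Γ`. -/
def defectToSpace (Γ : H →L[ℂ] H) : H →L[ℂ] defectSpace Γ :=
  (defectOp Γ).codRestrict (defectSpace Γ)
    (fun x => Submodule.le_topologicalClosure _ ⟨x, rfl⟩)

/-- The defect operator `D_Γ`, restricted to `𝔇_Γ`. -/
def defectOnSpace (Γ : H →L[ℂ] H) : defectSpace Γ →L[ℂ] H :=
  defectOp Γ ∘L (defectSpace Γ).subtypeL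

end PosDefZ3

end

/-! All three conditions say that `circulantForm` is nonnegative. Write `A = S* S` with `S` the
square root of `A = T 0` into its closed range (`B = T 1`). Restricting the form to two vectors
gives a Cauchy-Schwarz bound, hence `B = S* Γ₀ S` (`exists_contraction_of_norm_inner_le`). By
density `S` can be stripped off, leaving diagonal `1` and corner entry `Γ₀* = C + Γ₀²`. Completing
the square in the middle variable (`schur_complement_form`) leaves a two-variable form with weights
`D_Γ₀`, `D_Γ₀*` and cross term `C`, so the same factorization yields `Γ₁`. The identity read
backwards proves the converse. -/

namespace PosDefZ3

open ContinuousLinearMap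

/-! ### Factorization through contractions -/

section Factorization

variable {E F K L : Type*}
  [NormedAddCommGroup E] [InnerProductSpace ℂ E] [NormedAddCommGroup F] [InnerProductSpace ℂ F]
  [NormedAddCommGroup K] [InnerProductSpace ℂ K] [NormedAddCommGroup L] [InnerProductSpace ℂ L]

/-- Cauchy-Schwarz inequality for a positive `2 × 2` block form. -/
theorem norm_inner_le_of_form_nonneg {S : E →L[ℂ] K} {R : F →L[ℂ] L} {B : E →L[ℂ] F}
    (h : ∀ x y, 0 ≤ ‖S x‖ ^ 2 + ‖R y‖ ^ 2 + 2 * (inner ℂ y (B x)).re) (x : E) (y : F) :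
    ‖inner ℂ y (B x)‖ ≤ ‖S x‖ * ‖R y‖ := by
  obtain ⟨c, hc, hcz⟩ := RCLike.exists_norm_mul_eq_self (inner ℂ y (B x))
  -- Moving `y` by the phase `c` makes the pairing real; scaling `x` by `t` then gives a nonnegative
  -- quadratic, whose discriminant yields the bound.
  have hform : ∀ t : ℝ, 0 ≤ ‖S x‖ ^ 2 * (t * t) + (2 * ‖inner ℂ y (B x)‖) * t + ‖R y‖ ^ 2 := by
    intro t
    have h1 := h ((t : ℂ) • x) (c • y)
    have h2 : inner ℂ (c • y) (B ((t : ℂ) • x)) = ((t * ‖inner ℂ y (B x)‖ : ℝ) : ℂ) := by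
      rw [map_smul, inner_smul_left, inner_smul_right]
      nth_rw 1 [← hcz]
      have : (starRingEnd ℂ) c * c = 1 := by
        rw [mul_comm, Complex.mul_conj, Complex.normSq_eq_norm_sq, hc]; simp
      push_cast
      linear_combination (t * (‖inner ℂ y (B x)‖ : ℂ)) * this
    rw [h2, Complex.ofReal_re, map_smul, map_smul, norm_smul, norm_smul, hc, Complex.norm_real,
      mul_pow, Real.norm_eq_abs, sq_abs] at h1
    linarith
  have hd := discrim_le_zero hform
  rw [discrim] at hd
  refine abs_le_of_sq_le_sq' ?_ (by positivity) |>.2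
  nlinarith

variable [CompleteSpace F] [CompleteSpace K] [CompleteSpace L]

/-- An operator dominated by two operators with dense range factors through them by a
contraction. -/
theorem exists_contraction_of_norm_inner_le {S : E →L[ℂ] K} {R : F →L[ℂ] L}
    (hS : DenseRange S) (hR : DenseRange R) (B : E →L[ℂ] F)
    (h : ∀ x y, ‖inner ℂ y (B x)‖ ≤ ‖S x‖ * ‖R y‖) :
    ∃ Γ : K →L[ℂ] L, ‖Γ‖ ≤ 1 ∧ B = adjoint R ∘L Γ ∘L S := by
  -- Test the hypothesis at `y = B x`.
  have hB : ∀ x, ‖(B : E →ₗ[ℂ] F) x‖ ≤ ‖R‖ * ‖(S : E →ₗ[ℂ] K) x‖ := fun x => by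
    by_cases h0 : B x = 0
    · simp only [coe_coe, h0, norm_zero]; positivity
    · refine le_of_mul_le_mul_right ?_ (norm_pos_iff.2 h0)
      have h1 := h x (B x)
      rw [inner_self_eq_norm_sq_to_K, norm_pow, RCLike.norm_ofReal, abs_norm, sq] at h1
      refine h1.trans ?_
      have h2 := mul_le_mul_of_nonneg_left (R.le_opNorm (B x)) (norm_nonneg (S x))
      simp only [coe_coe]
      linarith
  let C : K →L[ℂ] F := (B : E →ₗ[ℂ] F).extendOfNorm (S : E →ₗ[ℂ] K)
  have hC : ∀ x, C (S x) = B x := LinearMap.extendOfNorm_eq (f := (B : E →ₗ[ℂ] F)) hS ⟨_, hB⟩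
  have hC' : ∀ k y, ‖inner ℂ y (C k)‖ ≤ ‖k‖ * ‖R y‖ := fun k y => by
    refine hS.induction_on (p := fun k => ‖inner ℂ y (C k)‖ ≤ ‖k‖ * ‖R y‖) k
      (isClosed_le (by fun_prop) (by fun_prop)) fun x => ?_
    rw [hC]
    exact h x y
  -- The sharp bound by `R` is visible only on the adjoint side, so `R` is factored out of `C*`, and
  -- `Γ` is the adjoint of the resulting contraction.
  have hCa : ∀ y, ‖(adjoint C : F →ₗ[ℂ] K) y‖ ≤ 1 * ‖(R : F →ₗ[ℂ] L) y‖ := fun y => by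
    simp only [coe_coe, one_mul]
    by_cases h0 : adjoint C y = 0
    · rw [h0, norm_zero]; positivity
    · refine le_of_mul_le_mul_left ?_ (norm_pos_iff.2 h0)
      have h1 := hC' (adjoint C y) y
      rwa [← adjoint_inner_left, inner_self_eq_norm_sq_to_K, norm_pow, RCLike.norm_ofReal,
        abs_norm, sq] at h1
  let G : L →L[ℂ] K := (adjoint C : F →ₗ[ℂ] K).extendOfNorm (R : F →ₗ[ℂ] L)
  have hG : ∀ y, G (R y) = adjoint C y :=
    LinearMap.extendOfNorm_eq (f := (adjoint C : F →ₗ[ℂ] K)) hR ⟨_, hCa⟩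
  refine ⟨adjoint G, ?_, ?_⟩
  · rw [LinearIsometryEquiv.norm_map]
    exact LinearMap.opNorm_extendOfNorm_le hR zero_le_one hCa
  · ext x
    refine ext_inner_left ℂ fun y => ?_
    simp only [comp_apply]
    rw [adjoint_inner_right, adjoint_inner_right, hG, adjoint_inner_left, hC]

end Factorization

/-- Over `ℂ`, a real-valued quadratic form already forces symmetry. -/
theorem isPositive_iff_inner_nonneg {E : Type*} [NormedAddCommGroup E] [InnerProductSpace ℂ E]
    (A : E →L[ℂ] E) :
    A.IsPositive ↔ ∀ x, 0 ≤ inner ℂ x (A x) := by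
  refine ⟨fun h x => h.inner_nonneg_right x, fun h => (isPositive_iff_complex A).2 fun x => ?_⟩
  have h1 : 0 ≤ inner ℂ (A x) x := by
    rw [← inner_conj_symm, Complex.conj_eq_iff_im.2 (Complex.nonneg_iff.1 (h x)).2.symm]
    exact h x
  have h2 := Complex.nonneg_iff.1 h1
  exact ⟨Complex.ext rfl (by simpa using h2.2), h2.1⟩

/-! ### Square roots and defect operators -/

variable {H : Type*} [NormedAddCommGroup H] [InnerProductSpace ℂ H] [CompleteSpace H]

theorem adjoint_sqrt (A : H →L[ℂ] H) : adjoint (CFC.sqrt A) = CFC.sqrt A :=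
  ((nonneg_iff_isPositive _).1 (CFC.sqrt_nonneg A)).isSelfAdjoint.adjoint_eq

theorem sqrt_sqrt_apply {A : H →L[ℂ] H} (hA : A.IsPositive) (x : H) :
    CFC.sqrt A (CFC.sqrt A x) = A x := by
  rw [← mul_apply_eq_comp, CFC.sqrt_mul_sqrt_self A ((nonneg_iff_isPositive _).2 hA)]

theorem sqrtOnClosedRange_eq_adjoint (A : H →L[ℂ] H) :
    sqrtOnClosedRange A = adjoint (sqrtToClosedRange A) := by
  rw [eq_adjoint_iff]
  intro x y
  change inner ℂ (CFC.sqrt A x) y = inner ℂ (x : H) (CFC.sqrt A y)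
  rw [← adjoint_inner_right, adjoint_sqrt]

theorem defectOnSpace_eq_adjoint (Γ : H →L[ℂ] H) :
    defectOnSpace Γ = adjoint (defectToSpace Γ) := by
  rw [eq_adjoint_iff]
  intro x y
  change inner ℂ (defectOp Γ x) y = inner ℂ (x : H) (defectOp Γ y)
  rw [← adjoint_inner_right, defectOp, adjoint_sqrt]

/-- Since `A = A^{1/2} A^{1/2}`, the range of `A` lies inside that of `A^{1/2}`. -/
theorem denseRange_sqrtToClosedRange {A : H →L[ℂ] H} (hA : A.IsPositive) :
    DenseRange (sqrtToClosedRange A) := by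
  intro k
  rw [Topology.IsInducing.subtypeVal.closure_eq_preimage_closure_image]
  refine closure_mono ?_ (k.2 : (k : H) ∈ closure (A.range : Set H))
  rintro _ ⟨x, rfl⟩
  exact ⟨_, ⟨CFC.sqrt A x, rfl⟩, sqrt_sqrt_apply hA x⟩

theorem denseRange_defectToSpace (Γ : H →L[ℂ] H) : DenseRange (defectToSpace Γ) := by
  intro k
  rw [Topology.IsInducing.subtypeVal.closure_eq_preimage_closure_image]
  refine closure_mono ?_ (k.2 : (k : H) ∈ closure ((defectOp Γ).range : Set H))
  rintro _ ⟨x, rfl⟩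
  exact ⟨_, ⟨x, rfl⟩, rfl⟩

theorem adjoint_sqrtToClosedRange_comp_self {A : H →L[ℂ] H} (hA : A.IsPositive) :
    adjoint (sqrtToClosedRange A) ∘L sqrtToClosedRange A = A := by
  rw [← sqrtOnClosedRange_eq_adjoint]
  ext x
  exact sqrt_sqrt_apply hA x

theorem norm_defectToSpace_sq {Γ : H →L[ℂ] H} (hΓ : ‖Γ‖ ≤ 1) (x : H) :
    ‖defectToSpace Γ x‖ ^ 2 = ‖x‖ ^ 2 - ‖Γ x‖ ^ 2 := by
  have hinner : ∀ x, inner ℂ x ((1 - adjoint Γ ∘L Γ) x) = ((‖x‖ ^ 2 - ‖Γ x‖ ^ 2 : ℝ) : ℂ) := by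
    intro x
    rw [sub_apply, inner_sub_right, comp_apply, adjoint_inner_right, one_apply_eq_self,
      inner_self_eq_norm_sq_to_K, inner_self_eq_norm_sq_to_K]
    push_cast
    rfl
  have hpos : (1 - adjoint Γ ∘L Γ).IsPositive := by
    rw [isPositive_iff']
    refine ⟨(IsSelfAdjoint.one _).sub (isPositive_adjoint_comp_self Γ).isSelfAdjoint, fun x => ?_⟩
    rw [← inner_conj_symm, hinner, Complex.conj_ofReal, Complex.zero_le_real, sub_nonneg]
    have := Γ.le_of_opNorm_le hΓ x
    rw [one_mul] at this
    gcongr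
  have h : inner ℂ (defectOp Γ x) (defectOp Γ x) = inner ℂ x ((1 - adjoint Γ ∘L Γ) x) := by
    rw [← sqrt_sqrt_apply hpos, ← adjoint_inner_left (CFC.sqrt _), adjoint_sqrt, defectOp]
  rw [hinner, inner_self_eq_norm_sq_to_K] at h
  exact Complex.ofReal_injective ((Complex.ofReal_pow _ _).trans h)

/-! ### The quadratic form and its Schur complement -/

/-- The quadratic form of the block Toeplitz matrix with diagonal `A` and off-diagonal entries
`B`, `B*`. -/
noncomputable def circulantForm (A B : H →L[ℂ] H) (x₀ x₁ x₂ : H) : ℂ :=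
  inner ℂ x₀ (A x₀ + B x₁ + adjoint B x₂) + inner ℂ x₁ (adjoint B x₀ + A x₁ + B x₂) +
    inner ℂ x₂ (B x₀ + adjoint B x₁ + A x₂)

theorem isPositive_blockOperator_iff (A B : H →L[ℂ] H) :
    (blockOperator !![A, B, adjoint B; adjoint B, A, B; B, adjoint B, A]).IsPositive ↔
      ∀ x₀ x₁ x₂, 0 ≤ circulantForm A B x₀ x₁ x₂ := by
  have key : ∀ x : PiLp 2 (fun _ : Fin 3 => H),
      inner ℂ x (blockOperator !![A, B, adjoint B; adjoint B, A, B; B, adjoint B, A] x) =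
        circulantForm A B (x 0) (x 1) (x 2) := fun x => by
    simp [PiLp.inner_apply, blockOperator_apply, Fin.sum_univ_three, circulantForm, inner_add_right]
  rw [isPositive_iff_inner_nonneg]
  simp only [key]
  exact ⟨fun h x₀ x₁ x₂ => by simpa using h (WithLp.toLp 2 ![x₀, x₁, x₂]), fun h x => h _ _ _⟩

theorem isPositiveDefinite_zmod_three_iff (T : ZMod 3 → H →L[ℂ] H) :
    IsPositiveDefinite T ↔ adjoint (T 0) = T 0 ∧ T 2 = adjoint (T 1) ∧
      ∀ x₀ x₁ x₂, 0 ≤ circulantForm (T 0) (T 1) x₀ x₁ x₂ := by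
  have hsymm : (∀ s, T (-s) = adjoint (T s)) ↔ adjoint (T 0) = T 0 ∧ T 2 = adjoint (T 1) := by
    refine ⟨fun h => ⟨(h 0).symm, h 1⟩, fun ⟨h0, h1⟩ s => ?_⟩
    fin_cases s
    · exact h0.symm
    · exact h1
    · change T 1 = adjoint (T 2)
      rw [h1, adjoint_adjoint]
  rw [IsPositiveDefinite, hsymm, and_assoc]
  refine and_congr_right fun _ => and_congr_right fun h2 => ?_
  have key : ∀ h : ZMod 3 →₀ H,
      ∑ s ∈ h.support, ∑ t ∈ h.support, inner ℂ (h t) (T (-t + s) (h s)) =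
        circulantForm (T 0) (T 1) (h 0) (h 1) (h 2) := fun h => by
    have hsum : ∀ f : ZMod 3 → ℂ, (∀ s, h s = 0 → f s = 0) →
        ∑ s ∈ h.support, f s = f 0 + f 1 + f 2 := fun f hf =>
      (Finset.sum_subset h.support.subset_univ fun s _ hs =>
        hf s (Finsupp.notMem_support_iff.1 hs)).trans (Fin.sum_univ_three f)
    have hinner : ∀ s, ∑ t ∈ h.support, inner ℂ (h t) (T (-t + s) (h s)) =
        inner ℂ (h 0) (T (-0 + s) (h s)) + inner ℂ (h 1) (T (-1 + s) (h s)) +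
          inner ℂ (h 2) (T (-2 + s) (h s)) := fun s =>
      hsum _ fun t ht => by rw [ht, inner_zero_left]
    simp only [hinner]
    rw [hsum _ fun s hs => by simp [hs]]
    rw [show (-0 + 0 : ZMod 3) = 0 by decide, show (-1 + 0 : ZMod 3) = 2 by decide,
      show (-2 + 0 : ZMod 3) = 1 by decide, show (-0 + 1 : ZMod 3) = 1 by decide,
      show (-1 + 1 : ZMod 3) = 0 by decide, show (-2 + 1 : ZMod 3) = 2 by decide,
      show (-0 + 2 : ZMod 3) = 2 by decide, show (-1 + 2 : ZMod 3) = 1 by decide,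
      show (-2 + 2 : ZMod 3) = 0 by decide, h2, circulantForm]
    simp only [inner_add_right]
    ring
  simp only [key]
  refine ⟨fun h x₀ x₁ x₂ => ?_, fun h x => h _ _ _⟩
  exact h (Finsupp.equivFunOnFinite.symm (![x₀, x₁, x₂] : Fin 3 → H))

theorem isPositive_of_circulantForm_nonneg {A B : H →L[ℂ] H}
    (h : ∀ x₀ x₁ x₂, 0 ≤ circulantForm A B x₀ x₁ x₂) : A.IsPositive :=
  (isPositive_iff_inner_nonneg A).2 fun x => by simpa [circulantForm] using h x 0 0

/-- Off-diagonal terms occur in conjugate pairs, so the form is real. -/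
theorem circulantForm_eq {K : Type*} [NormedAddCommGroup K] [InnerProductSpace ℂ K]
    [CompleteSpace K] (S : H →L[ℂ] K) (B : H →L[ℂ] H) (x₀ x₁ x₂ : H) :
    circulantForm (adjoint S ∘L S) B x₀ x₁ x₂ =
      ((‖S x₀‖ ^ 2 + ‖S x₁‖ ^ 2 + ‖S x₂‖ ^ 2 + 2 * ((inner ℂ x₀ (B x₁)).re +
        (inner ℂ x₀ (adjoint B x₂)).re + (inner ℂ x₁ (B x₂)).re) : ℝ) : ℂ) := by
  have hre : ∀ z : ℂ, ((2 * z.re : ℝ) : ℂ) = z + (starRingEnd ℂ) z := fun z =>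
    (Complex.add_conj z).symm
  rw [mul_add, mul_add]
  push_cast [-Complex.ofReal_mul]
  rw [hre, hre, hre, inner_conj_symm, inner_conj_symm, inner_conj_symm]
  simp only [circulantForm, inner_add_right, comp_apply, adjoint_inner_right, adjoint_inner_left,
    inner_self_eq_norm_sq_to_K]
  simp only [Complex.coe_algebraMap]
  ring

/-- Schur complement of the middle entry of the block matrix
`[1, Γ, C + Γ²; Γ*, 1, Γ; (C + Γ²)*, Γ*, 1]`. -/
theorem schur_complement_form {Γ C : H →L[ℂ] H} (hΓ : ‖Γ‖ ≤ 1) (u₀ u₁ u₂ : H) :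
    ‖u₀‖ ^ 2 + ‖u₁‖ ^ 2 + ‖u₂‖ ^ 2 + 2 * ((inner ℂ u₀ (Γ u₁)).re +
        (inner ℂ u₀ (C u₂ + Γ (Γ u₂))).re + (inner ℂ u₁ (Γ u₂)).re) =
      ‖u₁ + (adjoint Γ u₀ + Γ u₂)‖ ^ 2 + (‖defectToSpace Γ u₂‖ ^ 2 +
        ‖defectToSpace (adjoint Γ) u₀‖ ^ 2 + 2 * (inner ℂ u₀ (C u₂)).re) := by
  rw [norm_defectToSpace_sq hΓ, norm_defectToSpace_sq ((LinearIsometryEquiv.norm_map _ _).trans_le hΓ),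
    @norm_add_sq ℂ, @norm_add_sq ℂ, inner_add_right, inner_add_right, ← adjoint_inner_left Γ (Γ u₂),
    ← adjoint_inner_left Γ u₁]
  have h := inner_re_symm (𝕜 := ℂ) u₁ (adjoint Γ u₀)
  simp at h ⊢
  rw [h]
  ring

theorem exists_contractions_of_circulantForm_nonneg {A B : H →L[ℂ] H}
    (h : ∀ x₀ x₁ x₂, 0 ≤ circulantForm A B x₀ x₁ x₂) :
    ∃ (Γ₀ : closedRange A →L[ℂ] closedRange A)
      (Γ₁ : defectSpace Γ₀ →L[ℂ] defectSpace (adjoint Γ₀)),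
      ‖Γ₀‖ ≤ 1 ∧ ‖Γ₁‖ ≤ 1 ∧
      B = sqrtOnClosedRange A ∘L Γ₀ ∘L sqrtToClosedRange A ∧
      adjoint B =
        sqrtOnClosedRange A ∘L
            (defectOnSpace (adjoint Γ₀) ∘L Γ₁ ∘L defectToSpace Γ₀) ∘L sqrtToClosedRange A +
          sqrtOnClosedRange A ∘L (Γ₀ ∘L Γ₀) ∘L sqrtToClosedRange A := by
  have hA := isPositive_of_circulantForm_nonneg h
  rw [sqrtOnClosedRange_eq_adjoint]
  have hAS := adjoint_sqrtToClosedRange_comp_self hA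
  have hS := denseRange_sqrtToClosedRange hA
  -- Only `S* S = A` and the density of the range of `S` matter from here on.
  generalize sqrtToClosedRange A = S at hS hAS ⊢
  have hform : ∀ x₀ x₁ x₂, 0 ≤ ‖S x₀‖ ^ 2 + ‖S x₁‖ ^ 2 + ‖S x₂‖ ^ 2 + 2 * ((inner ℂ x₀ (B x₁)).re +
        (inner ℂ x₀ (adjoint B x₂)).re + (inner ℂ x₁ (B x₂)).re) := fun x₀ x₁ x₂ => by
    have := h x₀ x₁ x₂
    rw [← hAS, circulantForm_eq] at this
    exact Complex.zero_le_real.1 this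
  obtain ⟨Γ, hΓ, hB⟩ := exists_contraction_of_norm_inner_le hS hS B
    (norm_inner_le_of_form_nonneg fun x y => by
      have := hform y x 0
      simp only [map_zero, norm_zero, inner_zero_right, Complex.zero_re] at this
      linarith)
  have hBa : adjoint B = adjoint S ∘L adjoint Γ ∘L S := by
    rw [hB, adjoint_comp, adjoint_comp, adjoint_adjoint, comp_assoc]
  have hformK : ∀ u₀ u₁ u₂, 0 ≤ ‖u₀‖ ^ 2 + ‖u₁‖ ^ 2 + ‖u₂‖ ^ 2 + 2 * ((inner ℂ u₀ (Γ u₁)).re +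
        (inner ℂ u₀ ((adjoint Γ - Γ ∘L Γ) u₂ + Γ (Γ u₂))).re + (inner ℂ u₁ (Γ u₂)).re) := by
    intro u₀ u₁ u₂
    refine hS.induction_on₃ (p := fun u₀ u₁ u₂ => 0 ≤ ‖u₀‖ ^ 2 + ‖u₁‖ ^ 2 + ‖u₂‖ ^ 2 +
      2 * ((inner ℂ u₀ (Γ u₁)).re + (inner ℂ u₀ ((adjoint Γ - Γ ∘L Γ) u₂ + Γ (Γ u₂))).re +
        (inner ℂ u₁ (Γ u₂)).re)) ?_ ?_ u₀ u₁ u₂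
    · exact isClosed_le (by fun_prop) (by fun_prop)
    · intro x₀ x₁ x₂
      have := hform x₀ x₁ x₂
      rw [hBa, hB] at this
      simp only [comp_apply, adjoint_inner_right S] at this
      simpa only [sub_apply, comp_apply, sub_add_cancel] using this
  obtain ⟨Γ₁, hΓ₁, hC⟩ := exists_contraction_of_norm_inner_le (denseRange_defectToSpace Γ)
    (denseRange_defectToSpace (adjoint Γ)) (adjoint Γ - Γ ∘L Γ)
    (norm_inner_le_of_form_nonneg fun x y => by
      -- This middle vector makes the completed square vanish.
      have := hformK y (-(adjoint Γ y + Γ x)) x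
      rw [schur_complement_form hΓ] at this
      simpa using this)
  refine ⟨Γ, Γ₁, hΓ, hΓ₁, hB, ?_⟩
  rw [defectOnSpace_eq_adjoint, ← hC, hBa, ← comp_add, ← add_comp, sub_add_cancel]

theorem circulantForm_nonneg_of_contractions {A B : H →L[ℂ] H} (hA : A.IsPositive)
    {Γ₀ : closedRange A →L[ℂ] closedRange A}
    {Γ₁ : defectSpace Γ₀ →L[ℂ] defectSpace (adjoint Γ₀)} (hΓ₀ : ‖Γ₀‖ ≤ 1) (hΓ₁ : ‖Γ₁‖ ≤ 1)
    (hB : B = sqrtOnClosedRange A ∘L Γ₀ ∘L sqrtToClosedRange A)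
    (hBa : adjoint B =
        sqrtOnClosedRange A ∘L
            (defectOnSpace (adjoint Γ₀) ∘L Γ₁ ∘L defectToSpace Γ₀) ∘L sqrtToClosedRange A +
          sqrtOnClosedRange A ∘L (Γ₀ ∘L Γ₀) ∘L sqrtToClosedRange A)
    (x₀ x₁ x₂ : H) : 0 ≤ circulantForm A B x₀ x₁ x₂ := by
  rw [sqrtOnClosedRange_eq_adjoint] at hB hBa
  have hAS := adjoint_sqrtToClosedRange_comp_self hA
  generalize sqrtToClosedRange A = S at hB hBa hAS
  rw [← comp_add, ← add_comp] at hBa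
  rw [← hAS, circulantForm_eq, Complex.zero_le_real, hBa, hB]
  simp only [comp_apply, adjoint_inner_right S, add_apply]
  have hs := schur_complement_form
    (C := defectOnSpace (adjoint Γ₀) ∘L Γ₁ ∘L defectToSpace Γ₀) hΓ₀ (S x₀) (S x₁) (S x₂)
  simp only [comp_apply] at hs
  rw [hs, defectOnSpace_eq_adjoint, adjoint_inner_right]
  refine add_nonneg (sq_nonneg _) ?_
  -- The cross term is at least `-ab` for `a`, `b` the two defect norms, and `2ab ≤ a² + b²`.
  have h1 := (abs_le.1 ((Complex.abs_re_le_norm _).trans (norm_inner_le_norm (𝕜 := ℂ)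
    (defectToSpace (adjoint Γ₀) (S x₀)) (Γ₁ (defectToSpace Γ₀ (S x₂)))))).1
  have h2 := Γ₁.le_of_opNorm_le hΓ₁ (defectToSpace Γ₀ (S x₂))
  rw [one_mul] at h2
  have h3 := mul_le_mul_of_nonneg_left h2 (norm_nonneg (defectToSpace (adjoint Γ₀) (S x₀)))
  nlinarith [sq_nonneg (‖defectToSpace (adjoint Γ₀) (S x₀)‖ - ‖defectToSpace Γ₀ (S x₂)‖)]

end PosDefZ3

open PosDefZ3 in
theorem mainTheorem12 {H : Type*} [NormedAddCommGroup H] [InnerProductSpace ℂ H]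
    [CompleteSpace H] (T : ZMod 3 → H →L[ℂ] H) :
    List.TFAE [
      IsPositiveDefinite T,
      T 2 = ContinuousLinearMap.adjoint (T 1) ∧
        (blockOperator
          !![T 0, T 1, ContinuousLinearMap.adjoint (T 1);
             ContinuousLinearMap.adjoint (T 1), T 0, T 1;
             T 1, ContinuousLinearMap.adjoint (T 1), T 0]).IsPositive,
      T 2 = ContinuousLinearMap.adjoint (T 1) ∧
        (T 0).IsPositive ∧
        ∃ (Γ₀ : closedRange (T 0) →L[ℂ] closedRange (T 0))
          (Γ₁ : defectSpace Γ₀ →L[ℂ] defectSpace (ContinuousLinearMap.adjoint Γ₀)),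
          ‖Γ₀‖ ≤ 1 ∧ ‖Γ₁‖ ≤ 1 ∧
          T 1 = sqrtOnClosedRange (T 0) ∘L Γ₀ ∘L sqrtToClosedRange (T 0) ∧
          ContinuousLinearMap.adjoint (T 1) =
            sqrtOnClosedRange (T 0) ∘L
                (defectOnSpace (ContinuousLinearMap.adjoint Γ₀) ∘L Γ₁ ∘L defectToSpace Γ₀) ∘L
                sqrtToClosedRange (T 0) +
              sqrtOnClosedRange (T 0) ∘L (Γ₀ ∘L Γ₀) ∘L sqrtToClosedRange (T 0)] := by
  -- Self-adjointness of `T 0`, the case `s = 0` of the symmetry condition, comes for free from the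
  -- form.
  have h12 : IsPositiveDefinite T ↔ T 2 = ContinuousLinearMap.adjoint (T 1) ∧
      ∀ x₀ x₁ x₂, 0 ≤ circulantForm (T 0) (T 1) x₀ x₁ x₂ := by
    rw [isPositiveDefinite_zmod_three_iff]
    exact ⟨fun h => h.2, fun h =>
      ⟨(isPositive_of_circulantForm_nonneg h.2).isSelfAdjoint.adjoint_eq, h⟩⟩
  rw [h12, isPositive_blockOperator_iff]
  tfae_have 1 ↔ 2 := Iff.rfl
  tfae_have 2 → 3 := by
    rintro ⟨h2, h⟩
    exact ⟨h2, isPositive_of_circulantForm_nonneg h, exists_contractions_of_circulantForm_nonneg h⟩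
  tfae_have 3 → 2 := by
    rintro ⟨h2, hA, Γ₀, Γ₁, hΓ₀, hΓ₁, hB, hBa⟩
    exact ⟨h2, fun x₀ x₁ x₂ =>
      circulantForm_nonneg_of_contractions (Γ₀ := Γ₀) (Γ₁ := Γ₁) hA hΓ₀ hΓ₁ hB hBa x₀ x₁ x₂⟩
  tfae_finish
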